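/- Let $v\in C^2(\mathbb R)$ be such that $d\mu(x)=e^{-v(x)}\,dx$ is a probability measure on $\mathbb R$, let $N\ge 0$ be an integer, and let $\mu^{N+1}=\mu\otimes\cdots\otimes\mu$ be the product measure on $\mathbb R^{N+1}$. Then there exists at least one $t\in\mathbb R$ such that the coordinate half-space $H_t=\{x\in\mathbb R^{N+1}: x_{N+1}\le t\}$ is stable for $\mu^{N+1}$. Here, for a probability measure $f(x)\,dx=e^{\psi(x)}\,dx$ on $\mathbb R^{N+1}$ with $\psi\in C^2(\mathbb R^{N+1})$, a set $A\subseteq\mathbb R^{N+1}$ with $C^2$ boundary, outer unit normal $\nu$ and area element $da$ on $\partial A$, the set $A$ is called stable if the following two conditions hold. (1) Stationarity: the generalized mean curvature $N\mathcal H-\langle D\psi,\nu\rangle$ is constant on $\partial A$, where $N\mathcal H$ is the sum of the principal curvatures of $\partial A$, i.e. the trace of the shape operator $-d\nu$. (2) For every $u\in C^\infty_0(\partial A)$ (smooth with compact support) with $\int_{\partial A}u\,f\,da=0$, $$\int_{\partial A} f\,\big(|D_{\partial A}u|^2-K^2u^2\big)\,da+\int_{\partial A} f\,u^2\,\langle D^2\psi\,\nu,\nu\rangle\,da\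 \ge\ 0,$$ where $D_{\partial A}u$ is the tangential gradient and $K^2$ is the sum of the squares of the principal curvatures of $\partial A$. -/

import Mathlib

open MeasureTheory
open scoped ContDiff

noncomputable section

namespace HalfSpaceStability

/-- Euclidean space of dimension `d`. -/
abbrev E (d : ℕ) : Type := EuclideanSpace ℝ (Fin d)

/-- The `d`-fold product `μ ⊗ ⋯ ⊗ μ` as a measure on Euclidean space. -/
def productMeasure (μ : Measure ℝ) (d : ℕ) : Measure (E d) :=
  (Measure.pi fun _ : Fin d => μ).map (WithLp.toLp 2)

/-- `m` has the density `e^ψ` with respect to Lebesgue measure, and `ψ` is of class `C²`. -/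
def HasLogDensity {d : ℕ} (m : Measure (E d)) (ψ : E d → ℝ) : Prop :=
  ContDiff ℝ 2 ψ ∧ m = volume.withDensity fun x => ENNReal.ofReal (Real.exp (ψ x))

/-- `ρ` is a `C²` defining function of `A`: its gradient does not vanish on the boundary of `A`,
which is the zero set of `ρ`, and the interior of `A` is `{ρ < 0}`. A set that has such a function
is a set with `C²` boundary, lying locally on one side of it. The set itself may be open or closed,
since all the notions below depend on the boundary and on its outer normal only. -/
structure IsDefiningFunction {d : ℕ} (ρ : E d → ℝ) (A : Set (E d)) : Prop where
  contDiff : ContDiff ℝ 2 ρ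
  interior_eq : interior A = {x | ρ x < 0}
  frontier_eq : frontier A = {x | ρ x = 0}
  gradient_ne_zero : ∀ x ∈ frontier A, gradient ρ x ≠ 0

/-- The unit normal of the level sets of `ρ`. On the boundary of a set with defining function `ρ`
it is the outer unit normal `ν`. -/
def unitNormal {d : ℕ} (ρ : E d → ℝ) (x : E d) : E d :=
  ‖gradient ρ x‖⁻¹ • gradient ρ x

/-- The orthogonal projection of the whole space onto the tangent space `ν(x)ᗮ`. -/
def tangentProj {d : ℕ} (ρ : E d → ℝ) (x : E d) : E d →L[ℝ] E d :=
  (Submodule.span ℝ {unitNormal ρ x})ᗮ.starProjection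

/-- The shape operator `-dν` of the boundary with respect to the unit normal `ν`, a symmetric
operator of the tangent space, extended by `0` to the normal direction. Its eigenvalues on the
tangent space are the principal curvatures. -/
def shapeOperator {d : ℕ} (ρ : E d → ℝ) (x : E d) : E d →L[ℝ] E d :=
  -((tangentProj ρ x).comp ((fderiv ℝ (unitNormal ρ) x).comp (tangentProj ρ x)))

/-- The sum of the principal curvatures, that is, `d - 1` times the mean curvature. -/
def sumCurv {d : ℕ} (ρ : E d → ℝ) (x : E d) : ℝ :=
  LinearMap.trace ℝ (E d) (shapeOperator ρ x).toLinearMap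

/-- `K²`, the sum of the squares of the principal curvatures. -/
def sumSqCurv {d : ℕ} (ρ : E d → ℝ) (x : E d) : ℝ :=
  LinearMap.trace ℝ (E d) ((shapeOperator ρ x).comp (shapeOperator ρ x)).toLinearMap

/-- The tangential gradient along the boundary of (the restriction of) `u`. -/
def tangentialGradient {d : ℕ} (ρ u : E d → ℝ) (x : E d) : E d :=
  tangentProj ρ x (gradient u x)

/-- The generalized mean curvature `N H - ⟨Dψ, ν⟩`. -/
def genMeanCurv {d : ℕ} (ψ ρ : E d → ℝ) (x : E d) : ℝ :=
  sumCurv ρ x - inner ℝ (gradient ψ x) (unitNormal ρ x)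

/-- The integral over the boundary of `A ⊆ ℝ^(N+1)` against the area element. -/
def boundaryIntegral {N : ℕ} (A : Set (E (N + 1))) (g : E (N + 1) → ℝ) : ℝ :=
  ∫ x in frontier A, g x ∂μHE[N]

/-- The quadratic form
`∫ f (|D_∂A u|² - K² u²) da + ∫ f u² ⟨D²ψ ν, ν⟩ da` over the boundary of `A`, where `f = e^ψ`. -/
def indexForm {N : ℕ} (ψ ρ : E (N + 1) → ℝ) (A : Set (E (N + 1))) (u : E (N + 1) → ℝ) : ℝ :=
  boundaryIntegral A (fun x =>
      Real.exp (ψ x) * (‖tangentialGradient ρ u x‖ ^ 2 - sumSqCurv ρ x * u x ^ 2)) +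
    boundaryIntegral A (fun x =>
      Real.exp (ψ x) * u x ^ 2 * fderiv ℝ (fderiv ℝ ψ) x (unitNormal ρ x) (unitNormal ρ x))

/-- Stationarity for the density `e^ψ` of a set with defining function `ρ`: the generalized mean
curvature is constant on the boundary. -/
def IsStationaryWith {d : ℕ} (ψ ρ : E d → ℝ) (A : Set (E d)) : Prop :=
  ∃ c : ℝ, ∀ x ∈ frontier A, genMeanCurv ψ ρ x = c

/-- `A` is stable for the measure `m = e^ψ dx`: it has a `C²` boundary, it is stationary, and the
index form is nonnegative on all smooth compactly supported functions whose weighted mean over the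
boundary is zero. The function `ψ` is determined by `m`, and the normal and the curvatures on the
boundary do not depend on the choice of `ρ`. -/
def IsStable {N : ℕ} (m : Measure (E (N + 1))) (A : Set (E (N + 1))) : Prop :=
  ∃ ψ ρ : E (N + 1) → ℝ, HasLogDensity m ψ ∧ IsDefiningFunction ρ A ∧
    IsStationaryWith ψ ρ A ∧
    ∀ u : E (N + 1) → ℝ, ContDiff ℝ ∞ u → HasCompactSupport u →
      boundaryIntegral A (fun x => u x * Real.exp (ψ x)) = 0 →
      0 ≤ indexForm ψ ρ A u

/-- The coordinate half-space `{x_(N+1) ≤ t}` of `ℝ^(N+1)`. -/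
def coordHalfSpace (N : ℕ) (t : ℝ) : Set (E (N + 1)) :=
  {x | x (Fin.last N) ≤ t}

end HalfSpaceStability

end

/-! ### A weighted Poincaré inequality on bounded intervals. -/

namespace HalfSpaceStability

open Filter Topology intervalIntegral

/-! The boundary of `H_t` is flat, and `⟨D²ψ ν, ν⟩ = -v''(t)` on it. Up to the factor `e^{-v(t)}`,
the index form is therefore `∫ |∇u|² dμ^N - v''(t) ∫ u² dμ^N`, and stability follows from a Poincaré
inequality for `μ^N` with constant `v''(t)`. Such inequalities tensorize with the same constant
(`poincare_pi`), so it suffices to find `t` for which `v''(t)` is a Poincaré constant of `μ` itself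
(`exists_poincareOnLine`).

If `v''(t) ≤ 0` for some `t`, this is immediate. If `v''` is positive, any `L ≥ 0` below the
potential `v'' - b' + v' b - b²` is a Poincaré constant (`poincareOnLine_of_riccati`). With `φ = exp
∫ b` this potential is `(-φ'' + v' φ' + v'' φ) / φ`, a Barta-type lower bound for the operator
governing the derivatives of eigenfunctions. If `v''` attains its minimum, `b = 0` works. Otherwise
`b = ε arctan` lifts the potential uniformly above `inf v''`: near infinity the drift term `v' b`
gains, and on a compact set `v''` already exceeds its infimum by a fixed amount. Some value `v''(t)`
then fits below the potential (`exists_riccati`). -/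

/-- The Poincaré inequality with constant `L` for the measure `μ` on the line. -/
def PoincareOnLine (μ : Measure ℝ) (L : ℝ) : Prop :=
  ∀ u : ℝ → ℝ, ContDiff ℝ 1 u → HasCompactSupport u →
    L * (∫ x, u x ^ 2 ∂μ - (∫ x, u x ∂μ) ^ 2) ≤ ∫ x, deriv u x ^ 2 ∂μ

/-- Duality turns the mean-zero problem for `w` into a Dirichlet problem for the primitive `F` of `w
e^{-v}`, with weight `e^v`. There the Riccati argument applies: expanding `(F' - (b - v') F)² ≥ 0`
and integrating by parts produces the potential in `hLv`. -/
theorem interval_poincare {v b w : ℝ → ℝ} (hv : ContDiff ℝ 2 v) (hb : ContDiff ℝ 1 b)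
    (hw : ContDiff ℝ 1 w) {L : ℝ} (hL : 0 ≤ L)
    (hLv : ∀ x, L ≤ deriv (deriv v) x - deriv b x + deriv v x * b x - b x ^ 2)
    {p q : ℝ} (hpq : p ≤ q) (hmean : ∫ x in p..q, w x * Real.exp (-v x) = 0) :
    L * ∫ x in p..q, w x ^ 2 * Real.exp (-v x) ≤
      ∫ x in p..q, deriv w x ^ 2 * Real.exp (-v x) := by
  have hv' : ContDiff ℝ 1 (deriv v) := by
    have : ContDiff ℝ (1 + 1) v := by simpa [one_add_one_eq_two] using hv
    exact (contDiff_succ_iff_deriv.1 this).2.2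
  have cv : Continuous v := hv.continuous
  have cv' : Continuous (deriv v) := hv'.continuous
  have cv'' : Continuous (deriv (deriv v)) := hv'.continuous_deriv le_rfl
  have cb : Continuous b := hb.continuous
  have cb' : Continuous (deriv b) := hb.continuous_deriv le_rfl
  have cw : Continuous w := hw.continuous
  have cw' : Continuous (deriv w) := hw.continuous_deriv le_rfl
  have dv : ∀ x, HasDerivAt v (deriv v x) x := fun x =>
    (hv.differentiable (by norm_num) x).hasDerivAt
  have dv' : ∀ x, HasDerivAt (deriv v) (deriv (deriv v) x) x := fun x =>
    (hv'.differentiable (by norm_num) x).hasDerivAt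
  have db : ∀ x, HasDerivAt b (deriv b x) x := fun x =>
    (hb.differentiable (by norm_num) x).hasDerivAt
  have dw : ∀ x, HasDerivAt w (deriv w x) x := fun x =>
    (hw.differentiable (by norm_num) x).hasDerivAt
  set F : ℝ → ℝ := fun x => ∫ y in p..x, w y * Real.exp (-v y) with hF
  have dF : ∀ x, HasDerivAt F (w x * Real.exp (-v x)) x := fun x =>
    (show Continuous fun y => w y * Real.exp (-v y) by fun_prop).integral_hasStrictDerivAt p x
      |>.hasDerivAt
  have cF : Continuous F := continuous_iff_continuousAt.2 fun x => (dF x).continuousAt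
  have hFp : F p = 0 := by simp [hF]
  have hFq : F q = 0 := hmean
  -- The derivative of `L F² (b - v') e^v - 2 L w F`. This function vanishes at `p` and `q` because
  -- `F` does, so `Φ'` can be added under the integral for free.
  set Φ' : ℝ → ℝ := fun x => L * (2 * F x * (w x * Real.exp (-v x)) *
      ((b x - deriv v x) * Real.exp (v x)) + F x ^ 2 *
      ((deriv b x - deriv (deriv v) x) * Real.exp (v x) +
        (b x - deriv v x) * (Real.exp (v x) * deriv v x))) -
      2 * L * (deriv w x * F x + w x * (w x * Real.exp (-v x))) with hΦ'
  have dΦ : ∀ x, HasDerivAt (fun x => L * (F x ^ 2 * ((b x - deriv v x) * Real.exp (v x))) -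
      2 * L * (w x * F x)) (Φ' x) x := fun x => by
    have := ((((dF x).pow 2).mul (((db x).sub (dv' x)).mul (dv x).exp)).const_mul L).sub
      (((dw x).mul (dF x)).const_mul (2 * L))
    exact this.congr_deriv (by simp [hΦ'])
  have cΦ' : Continuous Φ' := by fun_prop
  have h0 : ∫ x in p..q, Φ' x = 0 := by
    rw [integral_eq_sub_of_hasDerivAt (fun x _ => dΦ x) (cΦ'.intervalIntegrable _ _)]
    simp [hFp, hFq]
  have i1 : Continuous fun x => w x ^ 2 * Real.exp (-v x) := by fun_prop
  have i2 : Continuous fun x => deriv w x ^ 2 * Real.exp (-v x) := by fun_prop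
  have key : ∫ x in p..q, (L * (w x ^ 2 * Real.exp (-v x)) + Φ' x) ≤
      ∫ x in p..q, deriv w x ^ 2 * Real.exp (-v x) := by
    refine integral_mono_on hpq (((i1.const_mul L).add cΦ').intervalIntegrable _ _)
      (i2.intervalIntegrable _ _) fun x _ => ?_
    have e : Real.exp (v x) * Real.exp (-v x) = 1 := by
      rw [← Real.exp_add]; simp
    have hpos := Real.exp_pos (v x)
    simp only [hΦ']
    set r := Real.exp (-v x)
    set s := Real.exp (v x)
    have h1 : 0 ≤ (deriv w x * r + L * F x) ^ 2 * s := by positivity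
    have h2 : 0 ≤ L * ((w x * r - (b x - deriv v x) * F x) ^ 2 * s) := by positivity
    have h3 : 0 ≤ L * (F x ^ 2 * s * (deriv (deriv v) x - deriv b x + deriv v x * b x -
        b x ^ 2 - L)) :=
      mul_nonneg hL (mul_nonneg (by positivity) (by linarith [hLv x]))
    -- Completing squares modulo `s * r = 1`: the pointwise deficit is the sum of the three
    -- nonnegative terms above.
    have h4 : deriv w x ^ 2 * r - (L * (w x ^ 2 * r) + (L * (2 * F x * (w x * r) *
        ((b x - deriv v x) * s) + F x ^ 2 * ((deriv b x - deriv (deriv v) x) * s +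
        (b x - deriv v x) * (s * deriv v x))) -
        2 * L * (deriv w x * F x + w x * (w x * r)))) =
        (deriv w x * r + L * F x) ^ 2 * s +
        L * ((w x * r - (b x - deriv v x) * F x) ^ 2 * s) +
        L * (F x ^ 2 * s * (deriv (deriv v) x - deriv b x + deriv v x * b x -
        b x ^ 2 - L)) := by
      linear_combination (-(deriv w x ^ 2 * r) - 2 * L * F x * deriv w x
         - L * w x ^ 2 * r) * e
    linarith
  rw [intervalIntegral.integral_add ((i1.const_mul L).intervalIntegrable _ _)
    (cΦ'.intervalIntegrable _ _), h0, add_zero, intervalIntegral.integral_const_mul] at key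
  exact key

end HalfSpaceStability

/-! ### From intervals to the whole line. -/

namespace HalfSpaceStability

open Filter Topology intervalIntegral

theorem integral_expDensity {X : Type*} [MeasurableSpace X] {m : Measure X} {ψ : X → ℝ}
    (hψ : Measurable ψ) (g : X → ℝ) :
    ∫ x, g x ∂(m.withDensity fun x => ENNReal.ofReal (Real.exp (ψ x))) =
      ∫ x, g x * Real.exp (ψ x) ∂m := by
  rw [integral_withDensity_eq_integral_toReal_smul (by fun_prop) (by simp)]
  simp [ENNReal.toReal_ofReal (Real.exp_pos _).le, mul_comm]

theorem integrable_exp_of_isProbabilityMeasure {v : ℝ → ℝ} (hv : Continuous v) {μ : Measure ℝ}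
    [IsProbabilityMeasure μ] (hμ : μ = volume.withDensity fun x => ENNReal.ofReal (Real.exp (-v x))) :
    Integrable (fun x => Real.exp (-v x)) := by
  refine ⟨by fun_prop, ?_⟩
  rw [hasFiniteIntegral_iff_ofReal (ae_of_all _ fun x => (Real.exp_pos _).le)]
  have : μ Set.univ = 1 := measure_univ
  rw [hμ, withDensity_apply _ MeasurableSet.univ, Measure.restrict_univ] at this
  rw [this]; exact ENNReal.one_lt_top

/-- The interval inequality is applied on `(-r, r)`, which contains the support of `u`, to `u` minus
its mean there. As `r → ∞` the mass of the interval tends to `1`. -/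
theorem poincareOnLine_of_riccati {v b : ℝ → ℝ} (hv : ContDiff ℝ 2 v) (hb : ContDiff ℝ 1 b)
    {μ : Measure ℝ} [IsProbabilityMeasure μ]
    (hμ : μ = volume.withDensity fun x => ENNReal.ofReal (Real.exp (-v x)))
    {L : ℝ} (hL : 0 ≤ L)
    (hLv : ∀ x, L ≤ deriv (deriv v) x - deriv b x + deriv v x * b x - b x ^ 2) :
    PoincareOnLine μ L := by
  intro u hu hsupp
  have cv : Continuous v := hv.continuous
  have cu : Continuous u := hu.continuous
  have hint := integrable_exp_of_isProbabilityMeasure cv hμ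
  have hone : ∫ x, Real.exp (-v x) = 1 := by
    have h := integral_expDensity (m := volume) (ψ := fun x => -v x) (by fun_prop) (fun _ => 1)
    rw [← hμ] at h
    simpa using h.symm
  have hI : ∀ g : ℝ → ℝ, ∫ x, g x ∂μ = ∫ x, g x * Real.exp (-v x) := fun g => by
    rw [hμ, integral_expDensity (by fun_prop)]
  rw [hI, hI, hI]
  set A := ∫ x, u x * Real.exp (-v x)
  set B := ∫ x, u x ^ 2 * Real.exp (-v x)
  set D := ∫ x, deriv u x ^ 2 * Real.exp (-v x)
  obtain ⟨R, hR⟩ : ∃ R, ∀ r > R, tsupport u ⊆ Set.Ioc (-r) r := by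
    obtain ⟨R, hR⟩ := hsupp.isCompact.isBounded.subset_closedBall 0
    refine ⟨R, fun r hr x hx => ?_⟩
    have := hR hx
    rw [Metric.mem_closedBall, Real.dist_eq, sub_zero, abs_le] at this
    exact ⟨by linarith, by linarith⟩
  have hM : Tendsto (fun r : ℝ => ∫ x in (-r)..r, Real.exp (-v x)) atTop (𝓝 1) := by
    rw [← hone]
    exact intervalIntegral_tendsto_integral hint tendsto_neg_atTop_atBot tendsto_id
  have hlim : Tendsto (fun r : ℝ => L * (B - A ^ 2 / ∫ x in (-r)..r, Real.exp (-v x))) atTop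
      (𝓝 (L * (B - A ^ 2))) := by
    simpa using (((tendsto_const_nhds (x := A ^ 2)).div hM one_ne_zero).const_sub B).const_mul L
  refine le_of_tendsto hlim ?_
  filter_upwards [eventually_gt_atTop R, eventually_gt_atTop 0] with r hr hr0
  have hsub : ∀ g : ℝ → ℝ, (∀ x, x ∉ tsupport u → g x = 0) →
      ∫ x in (-r)..r, g x = ∫ x, g x := fun g hg =>
    integral_eq_integral_of_support_subset fun x hx => hR r hr (by
      by_contra h; exact hx (hg x h))
  have hu0 : ∀ x, x ∉ tsupport u → u x = 0 := fun x => image_eq_zero_of_notMem_tsupport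
  have hu'0 : ∀ x, x ∉ tsupport u → deriv u x = 0 := fun x hx => by
    by_contra h
    exact hx (support_deriv_subset h)
  have hA : ∫ x in (-r)..r, u x * Real.exp (-v x) = A :=
    hsub _ fun x hx => by simp [hu0 x hx]
  have hB : ∫ x in (-r)..r, u x ^ 2 * Real.exp (-v x) = B :=
    hsub _ fun x hx => by simp [hu0 x hx]
  have hD : ∫ x in (-r)..r, deriv u x ^ 2 * Real.exp (-v x) = D :=
    hsub _ fun x hx => by simp [hu'0 x hx]
  have hMpos : 0 < ∫ x in (-r)..r, Real.exp (-v x) :=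
    intervalIntegral_pos_of_pos ((by fun_prop : Continuous fun x => Real.exp (-v x)).intervalIntegrable _ _)
      (fun x => Real.exp_pos _) (by linarith)
  set M := ∫ x in (-r)..r, Real.exp (-v x)
  have ii : ∀ g : ℝ → ℝ, Continuous g → IntervalIntegrable g volume (-r) r :=
    fun g hg => hg.intervalIntegrable _ _
  -- The mean over the interval is `A / M`, not `A`, since `μ` restricted to the interval has mass
  -- `M`.
  have h := interval_poincare hv hb (hu.sub (contDiff_const (c := A / M))) hL hLv
    (p := -r) (q := r) (by linarith) (by
      simp only [sub_mul]
      rw [intervalIntegral.integral_sub (ii _ (by fun_prop)) (ii _ (by fun_prop)),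
        intervalIntegral.integral_const_mul, hA]
      field_simp
      simp [M])
  have e1 : ∫ x in (-r)..r, (u x - A / M) ^ 2 * Real.exp (-v x) = B - A ^ 2 / M := by
    have : ∀ x, (u x - A / M) ^ 2 * Real.exp (-v x) = u x ^ 2 * Real.exp (-v x) -
      2 * (A / M) * (u x * Real.exp (-v x)) + (A / M) ^ 2 * Real.exp (-v x) := fun x => by ring
    simp only [this]
    rw [intervalIntegral.integral_add (ii _ (by fun_prop)) (ii _ (by fun_prop)),
      intervalIntegral.integral_sub (ii _ (by fun_prop)) (ii _ (by fun_prop)),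
      intervalIntegral.integral_const_mul, intervalIntegral.integral_const_mul, hA, hB]
    change _ + _ * M = _
    field_simp
    ring
  rw [e1] at h
  simpa [hD] using h

/-! ### Choice of the height `t`. -/

/-- Otherwise `v` is nonincreasing, and `e^{-v}` stays above the positive constant `e^{-v(0)}` on a
half-line of infinite length. -/
theorem exists_deriv_pos_of_integrable_exp_neg {v : ℝ → ℝ} (hv : Differentiable ℝ v)
    (hint : Integrable fun x => Real.exp (-v x)) : ∃ x, 0 < deriv v x := by
  by_contra! h
  have hanti : Antitone v := antitone_of_deriv_nonpos hv h
  have : IntegrableOn (fun _ : ℝ => Real.exp (-v 0)) (Set.Ici 0) := by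
    refine Integrable.mono' hint.integrableOn (by fun_prop) ?_
    filter_upwards [ae_restrict_mem measurableSet_Ici] with x hx
    rw [Real.norm_of_nonneg (Real.exp_pos _).le]
    exact Real.exp_le_exp.2 (neg_le_neg (hanti hx))
  simp [integrableOn_const_iff, (Real.exp_pos _).ne'] at this

theorem exists_deriv_neg_of_integrable_exp_neg {v : ℝ → ℝ} (hv : Differentiable ℝ v)
    (hint : Integrable fun x => Real.exp (-v x)) : ∃ x, deriv v x < 0 := by
  obtain ⟨x, hx⟩ := exists_deriv_pos_of_integrable_exp_neg (v := fun x => v (-x)) (by fun_prop)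
    hint.comp_neg
  rw [deriv_comp_neg] at hx
  exact ⟨-x, by linarith⟩

/-- If `v'' > 0` then some value `v''(t)` is bounded above by the potential
`v'' - b' + v' b - b²` for a suitable `b`. -/
theorem exists_riccati {v : ℝ → ℝ} (hv : ContDiff ℝ 2 v)
    (hint : Integrable fun x => Real.exp (-v x)) (hpos : ∀ x, 0 < deriv (deriv v) x) :
    ∃ t : ℝ, ∃ b : ℝ → ℝ, ContDiff ℝ 1 b ∧ ∀ x, deriv (deriv v) t ≤
      deriv (deriv v) x - deriv b x + deriv v x * b x - b x ^ 2 := by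
  by_cases hmin : ∃ t, ∀ x, deriv (deriv v) t ≤ deriv (deriv v) x
  · obtain ⟨t, ht⟩ := hmin
    exact ⟨t, fun _ => 0, contDiff_const, fun x => by simpa using ht x⟩
  push Not at hmin
  have hv' : ContDiff ℝ 1 (deriv v) := by
    have : ContDiff ℝ (1 + 1) v := by simpa [one_add_one_eq_two] using hv
    exact (contDiff_succ_iff_deriv.1 this).2.2
  have cv' : Continuous (deriv v) := hv'.continuous
  have cv'' : Continuous (deriv (deriv v)) := hv'.continuous_deriv le_rfl
  have hmono : Monotone (deriv v) :=
    monotone_of_deriv_nonneg (hv'.differentiable (by norm_num)) fun x => (hpos x).le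
  have hdv : Differentiable ℝ v := hv.differentiable (by norm_num)
  obtain ⟨x₁, h₁⟩ := exists_deriv_pos_of_integrable_exp_neg hdv hint
  obtain ⟨x₂, h₂⟩ := exists_deriv_neg_of_integrable_exp_neg hdv hint
  set κ := ⨅ x, deriv (deriv v) x with hκ
  have hbdd : BddBelow (Set.range (deriv (deriv v))) :=
    ⟨0, by rintro _ ⟨x, rfl⟩; exact (hpos x).le⟩
  have hκlt : ∀ x, κ < deriv (deriv v) x := fun x => by
    obtain ⟨y, hy⟩ := hmin x
    exact (ciInf_le hbdd y).trans_lt hy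
  set c := min (deriv v x₁) (-deriv v x₂) with hc
  have hcpos : 0 < c := lt_min h₁ (by linarith)
  -- Far out, monotonicity of `v'` gives `|v'| ≥ c` with the sign of `x`, and `|arctan x| ≥ π/4 ≥
  -- 1/2`. The drift is thus at least `c/2`, while `|x| ≥ 4/c` and `|x| ≥ 1` keep the loss `1/(1 +
  -- x²)` below `c/4`.
  obtain ⟨R, hR1, hR⟩ : ∃ R : ℝ, 1 ≤ R ∧ ∀ x, R ≤ |x| →
      c / 4 ≤ deriv v x * Real.arctan x - 1 / (1 + x ^ 2) := by
    refine ⟨max (max 1 (4 / c)) (max |x₁| |x₂|), by simp, fun x hx => ?_⟩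
    have hx1 : 1 ≤ |x| := le_trans (by simp) hx
    have hxc : 4 / c ≤ |x| := le_trans (by simp) hx
    have hxx1 : |x₁| ≤ |x| := le_trans (by simp) hx
    have hxx2 : |x₂| ≤ |x| := le_trans (by simp) hx
    have hpi : (1 / 2 : ℝ) ≤ Real.pi / 4 := by linarith [Real.pi_gt_three]
    have hdrift : c * (1 / 2) ≤ deriv v x * Real.arctan x := by
      rcases le_total 0 x with h | h
      · rw [abs_of_nonneg h] at *
        have ha : (1 / 2 : ℝ) ≤ Real.arctan x := by
          refine hpi.trans ?_
          rw [← Real.arctan_one]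
          exact Real.arctan_mono hx1
        exact mul_le_mul ((min_le_left _ _).trans (hmono ((le_abs_self _).trans hxx1))) ha
          (by norm_num) (h₁.le.trans (hmono ((le_abs_self _).trans hxx1)))
      · rw [abs_of_nonpos h] at *
        have ha : (1 / 2 : ℝ) ≤ Real.arctan (-x) := by
          refine hpi.trans ?_
          rw [← Real.arctan_one]
          exact Real.arctan_mono hx1
        have hm : deriv v x ≤ deriv v x₂ := hmono (by linarith [neg_abs_le x₂])
        have := mul_le_mul ((min_le_right (deriv v x₁) _).trans (neg_le_neg hm)) ha
          (by norm_num) (by linarith)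
        rw [Real.arctan_neg] at this
        linarith
    have hfrac : 1 / (1 + x ^ 2) ≤ c / 4 := by
      rw [div_le_div_iff₀ (by positivity) (by norm_num)]
      have h4 : 4 ≤ |x| * c := by rwa [div_le_iff₀ hcpos] at hxc
      have : |x| ≤ x ^ 2 := by rw [← sq_abs]; nlinarith
      nlinarith
    linarith
  have hcompact : IsCompact (Set.Icc (-R) R) := isCompact_Icc
  have hne : (Set.Icc (-R) R).Nonempty := ⟨0, by constructor <;> linarith⟩
  obtain ⟨z, -, hz⟩ := hcompact.exists_isMinOn hne cv''.continuousOn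
  have cξ : Continuous fun x : ℝ => deriv v x * Real.arctan x - 1 / (1 + x ^ 2) := by
    have : ∀ x : ℝ, 1 + x ^ 2 ≠ 0 := fun x => by positivity
    fun_prop (disch := assumption)
  obtain ⟨B, hB⟩ := hcompact.exists_bound_of_continuousOn cξ.continuousOn
  have hB0 : 0 ≤ B := (norm_nonneg _).trans (hB 0 ⟨by linarith, by linarith⟩)
  set η := deriv (deriv v) z - κ with hη
  have hηpos : 0 < η := sub_pos.2 (hκlt z)
  -- Since `arctan² ≤ 4`, the bound `ε ≤ c/32` keeps the quadratic loss below `c/8`, half the gain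
  -- outside `[-R, R]`. The last bound makes the total loss inside at most half of the surplus `η`.
  obtain ⟨ε, hε, hε1, hε2, hε3⟩ : ∃ ε : ℝ, 0 < ε ∧ ε ≤ 1 ∧ ε ≤ c / 32 ∧
      ε * (B + 4) ≤ η / 2 := by
    refine ⟨min 1 (min (c / 32) (η / 2 / (B + 4))), by positivity, by simp, by simp, ?_⟩
    calc _ ≤ η / 2 / (B + 4) * (B + 4) := by gcongr; simp
      _ = _ := by field_simp
  -- The potential exceeds `κ` by at least `η/2` inside `[-R, R]` and by `ε c/8` outside, so any `t`
  -- with `v''(t)` this close to the infimum will do.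
  obtain ⟨t, ht⟩ : ∃ t, deriv (deriv v) t < κ + min (η / 2) (ε * (c / 8)) :=
    exists_lt_of_ciInf_lt (lt_add_of_pos_right _ (by positivity))
  refine ⟨t, fun x => ε * Real.arctan x, contDiff_const.mul Real.contDiff_arctan, fun x => ?_⟩
  rw [deriv_const_mul _ (Real.differentiableAt_arctan x), Real.deriv_arctan]
  have hat : Real.arctan x ^ 2 ≤ 4 := by
    have h1 := Real.arctan_lt_pi_div_two x
    have h2 := Real.neg_pi_div_two_lt_arctan x
    have h3 := Real.pi_lt_four
    nlinarith
  have e : deriv (deriv v) x - ε * (1 / (1 + x ^ 2)) + deriv v x * (ε * Real.arctan x) -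
      (ε * Real.arctan x) ^ 2 = deriv (deriv v) x +
      ε * ((deriv v x * Real.arctan x - 1 / (1 + x ^ 2)) - ε * Real.arctan x ^ 2) := by ring
  rw [e]
  have hsq : ε * Real.arctan x ^ 2 ≤ ε * 4 := by gcongr
  rcases le_total R |x| with h | h
  · have h1 : c / 8 ≤ (deriv v x * Real.arctan x - 1 / (1 + x ^ 2)) - ε * Real.arctan x ^ 2 := by
      linarith [hR x h]
    have h2 := mul_le_mul_of_nonneg_left h1 hε.le
    linarith [min_le_right (η / 2) (ε * (c / 8)), hκlt x]
  · have hx : x ∈ Set.Icc (-R) R := abs_le.1 h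
    have h0 : deriv (deriv v) z ≤ deriv (deriv v) x := hz hx
    have h1 : -(B + 4) ≤ (deriv v x * Real.arctan x - 1 / (1 + x ^ 2)) -
        ε * Real.arctan x ^ 2 := by
      have := (abs_le.1 (hB x hx)).1
      linarith
    have h2 := mul_le_mul_of_nonneg_left h1 hε.le
    linarith [min_le_left (η / 2) (ε * (c / 8))]

theorem sq_integral_le {X : Type*} [MeasurableSpace X] {m : Measure X} [IsProbabilityMeasure m]
    {f : X → ℝ} (hf : Integrable f m) (hf2 : Integrable (fun x => f x ^ 2) m) :
    (∫ x, f x ∂m) ^ 2 ≤ ∫ x, f x ^ 2 ∂m := by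
  have h : 0 ≤ ∫ x, (f x - ∫ y, f y ∂m) ^ 2 ∂m := integral_nonneg fun x => sq_nonneg _
  set a := ∫ y, f y ∂m
  have e : ∀ x, (f x - a) ^ 2 = f x ^ 2 - 2 * a * f x + a ^ 2 := fun x => by ring
  simp only [e] at h
  have hi : Integrable (fun x => f x ^ 2 - 2 * a * f x) m := hf2.sub (hf.const_mul _)
  rw [integral_add hi (integrable_const _), integral_sub hf2 (hf.const_mul _), MeasureTheory.integral_const_mul] at h
  simp only [MeasureTheory.integral_const, probReal_univ, one_smul] at h
  change 0 ≤ _ - 2 * a * a + _ at h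
  linarith

/-- Some value of `v''` is a Poincaré constant of the probability measure `e^{-v} dx`. -/
theorem exists_poincareOnLine {v : ℝ → ℝ} (hv : ContDiff ℝ 2 v)
    {μ : Measure ℝ} [IsProbabilityMeasure μ]
    (hμ : μ = volume.withDensity fun x => ENNReal.ofReal (Real.exp (-v x))) :
    ∃ t, PoincareOnLine μ (deriv (deriv v) t) := by
  by_cases h : ∃ t, deriv (deriv v) t ≤ 0
  · obtain ⟨t, ht⟩ := h
    -- A variance is nonnegative, so a nonpositive constant makes the left side nonpositive.
    refine ⟨t, fun u hu hs => ?_⟩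
    have h1 : (∫ x, u x ∂μ) ^ 2 ≤ ∫ x, u x ^ 2 ∂μ := by
      have cu : Continuous u := hu.continuous
      refine sq_integral_le (cu.integrable_of_hasCompactSupport hs)
        (Continuous.integrable_of_hasCompactSupport (by fun_prop) ?_)
      exact hs.comp_left (g := fun y : ℝ => y ^ 2) (by simp)
    have h2 : 0 ≤ ∫ x, deriv u x ^ 2 ∂μ := integral_nonneg fun x => sq_nonneg _
    exact (mul_nonpos_of_nonpos_of_nonneg ht (by linarith)).trans h2
  · push Not at h
    obtain ⟨t, b, hb, ht⟩ := exists_riccati hv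
      (integrable_exp_of_isProbabilityMeasure hv.continuous hμ) h
    exact ⟨t, poincareOnLine_of_riccati hv hb hμ (h t).le ht⟩

end HalfSpaceStability

/-! ### Tensorization of the Poincaré inequality. -/

namespace HalfSpaceStability

open Filter Topology

section Product

variable {X : Type*} [NormedAddCommGroup X]

theorem hasCompactSupport_slice {f : ℝ × X → ℝ} (hf : HasCompactSupport f) (x : ℝ) :
    HasCompactSupport fun y => f (x, y) :=
  HasCompactSupport.intro (hf.isCompact.image continuous_snd) fun _ hy =>
    image_eq_zero_of_notMem_tsupport fun h => hy ⟨_, h, rfl⟩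

variable [MeasurableSpace X] {ν : Measure X}

theorem hasCompactSupport_integral_slice {f : ℝ × X → ℝ} (hf : HasCompactSupport f) :
    HasCompactSupport fun x => ∫ y, f (x, y) ∂ν :=
  HasCompactSupport.intro (hf.isCompact.image continuous_fst) fun x hx => by
    have : ∀ y, f (x, y) = 0 := fun y =>
      image_eq_zero_of_notMem_tsupport fun h => hx ⟨_, h, rfl⟩
    simp [this]

variable [BorelSpace X] [IsProbabilityMeasure ν]

theorem continuous_integral_slice {f : ℝ × X → ℝ} (hc : Continuous f) (hf : HasCompactSupport f) :
    Continuous fun x => ∫ y, f (x, y) ∂ν := by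
  obtain ⟨C, hC⟩ := hf.exists_bound_of_continuous hc
  exact continuous_of_dominated (bound := fun _ => C)
    (fun x => (by fun_prop : Continuous fun y => f (x, y)).aestronglyMeasurable)
    (fun x => ae_of_all _ fun y => hC _) (integrable_const _)
    (ae_of_all _ fun y => by fun_prop)

theorem integrable_slice {f : ℝ × X → ℝ} (hc : Continuous f) (hf : HasCompactSupport f) (x : ℝ) :
    Integrable (fun y => f (x, y)) ν :=
  (by fun_prop : Continuous fun y => f (x, y)).integrable_of_hasCompactSupport
    (hasCompactSupport_slice hf x)

variable [NormedSpace ℝ X] {μ : Measure ℝ} [IsProbabilityMeasure μ]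
  {U G : ℝ × X → ℝ}

theorem hasDerivAt_integral_slice (hU : ContDiff ℝ 1 U) (hs : HasCompactSupport U) (x : ℝ) :
    HasDerivAt (fun x => ∫ y, U (x, y) ∂ν) (∫ y, fderiv ℝ U (x, y) (1, 0) ∂ν) x := by
  have hc : Continuous fun p => fderiv ℝ U p (1, 0) :=
    (hU.continuous_fderiv one_ne_zero).clm_apply continuous_const
  have hs' : HasCompactSupport fun p => fderiv ℝ U p (1, 0) := hs.fderiv_apply ℝ _
  obtain ⟨C, hC⟩ := hs'.exists_bound_of_continuous hc
  have cU : Continuous U := hU.continuous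
  refine (hasDerivAt_integral_of_dominated_loc_of_deriv_le (bound := fun _ => C)
    (F' := fun x y => fderiv ℝ U (x, y) (1, 0)) univ_mem
    (Eventually.of_forall fun x =>
      (by fun_prop : Continuous fun y => U (x, y)).aestronglyMeasurable)
    (integrable_slice cU hs x)
    (hc.comp (by fun_prop : Continuous fun y : X => (x, y))).aestronglyMeasurable
    (ae_of_all _ fun y x _ => hC _) (integrable_const _) (ae_of_all _ fun y z _ => ?_)).2
  have h1 : HasFDerivAt U (fderiv ℝ U (z, y)) (z, y) :=
    (hU.differentiable one_ne_zero _).hasFDerivAt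
  exact h1.comp_hasDerivAt z ((hasDerivAt_id z).prodMk (hasDerivAt_const z y))

/-- One step of the tensorization of the Poincaré inequality. -/
theorem poincare_prod [SecondCountableTopology X] {L : ℝ} (hμ : PoincareOnLine μ L) (hU : ContDiff ℝ 1 U)
    (hs : HasCompactSupport U) (hG : Continuous G) (hGs : HasCompactSupport G)
    (hslice : ∀ x, L * (∫ y, U (x, y) ^ 2 ∂ν - (∫ y, U (x, y) ∂ν) ^ 2) ≤ ∫ y, G (x, y) ∂ν) :
    L * (∫ p, U p ^ 2 ∂(μ.prod ν) - (∫ p, U p ∂(μ.prod ν)) ^ 2) ≤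
      ∫ p, (fderiv ℝ U p (1, 0) ^ 2 + G p) ∂(μ.prod ν) := by
  have cU : Continuous U := hU.continuous
  have cD : Continuous fun p => fderiv ℝ U p (1, 0) :=
    (hU.continuous_fderiv one_ne_zero).clm_apply continuous_const
  have sD : HasCompactSupport fun p => fderiv ℝ U p (1, 0) := hs.fderiv_apply ℝ _
  have sU2 : HasCompactSupport fun p => U p ^ 2 :=
    hs.comp_left (g := fun y : ℝ => y ^ 2) (by simp)
  have sD2 : HasCompactSupport fun p => fderiv ℝ U p (1, 0) ^ 2 :=
    sD.comp_left (g := fun y : ℝ => y ^ 2) (by simp)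
  have cU2 : Continuous fun p => U p ^ 2 := by fun_prop
  have cD2 : Continuous fun p => fderiv ℝ U p (1, 0) ^ 2 := by fun_prop
  have ip : ∀ {f : ℝ × X → ℝ}, Continuous f → HasCompactSupport f → Integrable f (μ.prod ν) :=
    fun hf hf' => hf.integrable_of_hasCompactSupport hf'
  have il : ∀ {f : ℝ → ℝ}, Continuous f → HasCompactSupport f → Integrable f μ :=
    fun hf hf' => hf.integrable_of_hasCompactSupport hf'
  have dA := hasDerivAt_integral_slice (ν := ν) hU hs
  set A : ℝ → ℝ := fun x => ∫ y, U (x, y) ∂ν with hA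
  have hA' : deriv A = fun x => ∫ y, fderiv ℝ U (x, y) (1, 0) ∂ν := funext fun x => (dA x).deriv
  have cA' : Continuous (deriv A) := hA' ▸ continuous_integral_slice cD sD
  have hA1 : ContDiff ℝ 1 A :=
    contDiff_one_iff_deriv.2 ⟨fun x => (dA x).differentiableAt, cA'⟩
  have sA : HasCompactSupport A := hasCompactSupport_integral_slice hs
  have hpoin := hμ A hA1 sA
  have iA2 : Integrable (fun x => A x ^ 2) μ :=
    il (hA1.continuous.pow 2) (sA.comp_left (g := fun y : ℝ => y ^ 2) (by simp))
  have iU2 : Integrable (fun x => ∫ y, U (x, y) ^ 2 ∂ν) μ :=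
    il (continuous_integral_slice cU2 sU2) (hasCompactSupport_integral_slice sU2)
  have iG : Integrable (fun x => ∫ y, G (x, y) ∂ν) μ :=
    il (continuous_integral_slice hG hGs) (hasCompactSupport_integral_slice hGs)
  -- The variance splits into the mean of the slice variances, bounded here, and the variance of the
  -- slice mean `A`, bounded by `hpoin`. No sign of `L` is needed.
  have h1 : L * (∫ x, ∫ y, U (x, y) ^ 2 ∂ν ∂μ - ∫ x, A x ^ 2 ∂μ) ≤ ∫ x, ∫ y, G (x, y) ∂ν ∂μ := by
    rw [← integral_sub iU2 iA2, ← integral_const_mul]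
    exact integral_mono ((iU2.sub iA2).const_mul L) iG hslice
  -- Differentiation under the integral, then Cauchy–Schwarz in `y`.
  have h2 : ∫ x, deriv A x ^ 2 ∂μ ≤ ∫ x, ∫ y, fderiv ℝ U (x, y) (1, 0) ^ 2 ∂ν ∂μ := by
    have iA' : Integrable (fun x => deriv A x ^ 2) μ :=
      il (cA'.pow 2) (sA.deriv.comp_left (g := fun y : ℝ => y ^ 2) (by simp))
    have iD2 : Integrable (fun x => ∫ y, fderiv ℝ U (x, y) (1, 0) ^ 2 ∂ν) μ :=
      il (continuous_integral_slice (f := fun p => fderiv ℝ U p (1, 0) ^ 2) cD2 sD2)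
        (hasCompactSupport_integral_slice (f := fun p => fderiv ℝ U p (1, 0) ^ 2) sD2)
    refine integral_mono iA' iD2 fun x => ?_
    have hx : deriv A x = ∫ y, fderiv ℝ U (x, y) (1, 0) ∂ν := (dA x).deriv
    have := sq_integral_le (m := ν) (f := fun y => fderiv ℝ U (x, y) (1, 0))
      (integrable_slice cD sD x) (integrable_slice cD2 sD2 x)
    rw [← hx] at this
    exact this
  rw [integral_add (ip cD2 sD2) (ip hG hGs), integral_prod _ (ip cU2 sU2),
    integral_prod _ (ip cU hs), integral_prod _ (ip cD2 sD2), integral_prod _ (ip hG hGs)]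
  change L * (_ - (∫ x, A x ∂μ) ^ 2) ≤ _
  linarith

end Product

/-- The Poincaré inequality on the line tensorizes. -/
theorem poincare_pi {μ : Measure ℝ} [IsProbabilityMeasure μ] {L : ℝ} (hμ : PoincareOnLine μ L)
    (n : ℕ) (u : (Fin n → ℝ) → ℝ) (hu : ContDiff ℝ 1 u) (hs : HasCompactSupport u) :
    L * (∫ x, u x ^ 2 ∂(Measure.pi fun _ => μ) - (∫ x, u x ∂(Measure.pi fun _ => μ)) ^ 2) ≤
      ∫ x, ∑ i, fderiv ℝ u x (Pi.single i 1) ^ 2 ∂(Measure.pi fun _ => μ) := by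
  induction n with
  -- A unit point mass has zero variance. This covers `N = 0`, where the boundary is a single point.
  | zero => simp [Measure.pi_of_empty (fun _ : Fin 0 => μ) (x := 0)]
  | succ n ih =>
    let e : (ℝ × (Fin n → ℝ)) ≃L[ℝ] (Fin (n + 1) → ℝ) := Fin.consEquivL ℝ (fun _ => ℝ)
    have he : ∀ p, e p = Fin.cons p.1 p.2 := fun p => rfl
    have hpres : ∀ f : (Fin (n + 1) → ℝ) → ℝ, ∫ x, f x ∂(Measure.pi fun _ => μ) =
        ∫ p, f (e p) ∂(μ.prod (Measure.pi fun _ => μ)) := fun f => by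
      rw [← ((measurePreserving_piFinSuccAbove (fun _ => μ) 0).symm).integral_comp']
      simp [MeasurableEquiv.piFinSuccAbove_symm_apply, Fin.insertNthEquiv, he]
    have hU : ContDiff ℝ 1 (u ∘ e) := hu.comp e.contDiff
    have hUs : HasCompactSupport (u ∘ e) := hs.comp_homeomorph e.toHomeomorph
    have hd : ∀ p w, fderiv ℝ (u ∘ e) p w = fderiv ℝ u (e p) (e w) := fun p w => by
      rw [e.comp_right_fderiv]; rfl
    have e0 : e (1, 0) = Pi.single 0 1 := by
      rw [he]; ext i; refine Fin.cases ?_ (fun j => ?_) i <;> simp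
    have e1 : ∀ i : Fin n, e (0, Pi.single i 1) = Pi.single i.succ 1 := fun i => by
      rw [he]; ext j; refine Fin.cases ?_ (fun k => ?_) j
      · simp
      · simp [Pi.single_apply]
    have cd : ∀ w, Continuous fun p => fderiv ℝ (u ∘ e) p w := fun w =>
      (hU.continuous_fderiv one_ne_zero).clm_apply continuous_const
    have hGs : HasCompactSupport fun p => ∑ i : Fin n,
        fderiv ℝ (u ∘ e) p (0, Pi.single i 1) ^ 2 := by
      refine (hUs.fderiv (𝕜 := ℝ)).comp_left
        (g := fun T : ℝ × (Fin n → ℝ) →L[ℝ] ℝ => ∑ i : Fin n, T (0, Pi.single i 1) ^ 2) (by simp)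
    have cG : Continuous fun p => ∑ i : Fin n, fderiv ℝ (u ∘ e) p (0, Pi.single i 1) ^ 2 :=
      continuous_finsetSum _ fun i _ => (cd _).pow 2
    have key := poincare_prod (ν := Measure.pi fun _ : Fin n => μ) hμ hU hUs cG hGs (fun x => by
        have hx : ContDiff ℝ 1 fun y => (u ∘ e) (x, y) := hU.comp (by fun_prop)
        convert ih _ hx (hasCompactSupport_slice hUs x) using 5 with y i
        have h1 : HasFDerivAt (u ∘ e) (fderiv ℝ (u ∘ e) (x, y)) (x, y) :=
          (hU.differentiable one_ne_zero _).hasFDerivAt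
        have h2 := h1.comp y (hasFDerivAt_prodMk_right x y)
        rw [show (fun y => (u ∘ e) (x, y)) = (u ∘ e) ∘ fun y => (x, y) from rfl, h2.fderiv]
        simp)
    rw [hpres, hpres, hpres]
    simp only [hd, e0, e1] at key
    simpa only [Fin.sum_univ_succ, Function.comp_apply] using key

end HalfSpaceStability

/-! ### The product density and its derivatives. -/

namespace HalfSpaceStability

open Filter Topology

theorem lintegral_pi_prod {n : ℕ} (m : Fin n → Measure ℝ) [∀ i, SigmaFinite (m i)]
    {f : ℝ → ENNReal} (hf : Measurable f) :
    ∫⁻ x, ∏ i, f (x i) ∂(Measure.pi m) = ∏ i, ∫⁻ x, f x ∂(m i) := by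
  induction n with
  | zero => simp
  | succ n ih =>
    rw [← ((measurePreserving_piFinSuccAbove m 0).symm).lintegral_comp_emb
      (MeasurableEquiv.measurableEmbedding _)]
    simp_rw [MeasurableEquiv.piFinSuccAbove_symm_apply, Fin.insertNthEquiv,
      Fin.prod_univ_succ, Fin.insertNth_zero]
    simp only [Fin.zero_succAbove, Equiv.coe_fn_mk, Fin.cons_zero, Fin.cons_succ]
    have hprod : Measurable fun x : Fin n → ℝ => ∏ i, f (x i) :=
      Finset.measurable_fun_prod _ fun i _ => hf.comp (measurable_pi_apply i)
    rw [← ih, ← lintegral_prod_mul hf.aemeasurable hprod.aemeasurable]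
    rfl

theorem pi_eq_withDensity {v : ℝ → ℝ} (hv : Continuous v) {μ : Measure ℝ} [IsProbabilityMeasure μ]
    (hμ : μ = volume.withDensity fun x => ENNReal.ofReal (Real.exp (-v x))) (n : ℕ) :
    (Measure.pi fun _ : Fin n => μ) =
      volume.withDensity fun x => ENNReal.ofReal (Real.exp (∑ i, -v (x i))) := by
  refine Measure.pi_eq fun s hs => ?_
  rw [withDensity_apply _ (MeasurableSet.univ_pi hs), volume_pi, Measure.restrict_pi_pi]
  simp_rw [Real.exp_sum, ENNReal.ofReal_prod_of_nonneg fun _ _ => (Real.exp_pos _).le]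
  rw [lintegral_pi_prod (fun i => volume.restrict (s i))
    (f := fun x => ENNReal.ofReal (Real.exp (-v x))) (by fun_prop)]
  exact Finset.prod_congr rfl fun i _ => by rw [hμ, withDensity_apply _ (hs i)]

/-- The logarithm of the density of the product measure. -/
def logDensity (v : ℝ → ℝ) (d : ℕ) (x : E d) : ℝ := ∑ i, -v (x i)

theorem hasLogDensity_productMeasure {v : ℝ → ℝ} (hv : ContDiff ℝ 2 v) {μ : Measure ℝ}
    [IsProbabilityMeasure μ]
    (hμ : μ = volume.withDensity fun x => ENNReal.ofReal (Real.exp (-v x))) (d : ℕ) :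
    HasLogDensity (productMeasure μ d) (logDensity v d) := by
  have cv := hv.continuous
  refine ⟨?_, ?_⟩
  · unfold logDensity
    exact ContDiff.sum fun i _ => (hv.comp (by fun_prop)).neg
  · ext s hs
    have hmp := PiLp.volume_preserving_toLp (Fin d)
    unfold productMeasure logDensity
    rw [Measure.map_apply hmp.measurable hs, pi_eq_withDensity cv hμ,
      withDensity_apply _ (hmp.measurable hs), withDensity_apply _ hs,
      ← hmp.setLIntegral_comp_preimage hs (by fun_prop)]

theorem hasFDerivAt_logDensity {v : ℝ → ℝ} (hv : ContDiff ℝ 2 v) {d : ℕ} (x : E d) :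
    HasFDerivAt (logDensity v d)
      (∑ i, (-deriv v (x i)) • (EuclideanSpace.proj i : E d →L[ℝ] ℝ)) x := by
  refine HasFDerivAt.fun_sum fun i _ => ?_
  have h1 : HasDerivAt v (deriv v (x i)) (x i) := (hv.differentiable (by norm_num) _).hasDerivAt
  exact h1.fun_neg.comp_hasFDerivAt (f := fun y : E d => y i) x
    (EuclideanSpace.proj i : E d →L[ℝ] ℝ).hasFDerivAt

theorem fderiv_fderiv_logDensity {v : ℝ → ℝ} (hv : ContDiff ℝ 2 v) {d : ℕ} (x y z : E d) :
    fderiv ℝ (fderiv ℝ (logDensity v d)) x y z =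
      ∑ i, -deriv (deriv v) (x i) * y i * z i := by
  have hv' : ContDiff ℝ 1 (deriv v) := by
    have : ContDiff ℝ (1 + 1) v := by simpa [one_add_one_eq_two] using hv
    exact (contDiff_succ_iff_deriv.1 this).2.2
  have h : HasFDerivAt (fun x : E d => ∑ i, (-deriv v (x i)) • (EuclideanSpace.proj i : E d →L[ℝ] ℝ))
      (∑ i, ((-deriv (deriv v) (x i)) • (EuclideanSpace.proj i : E d →L[ℝ] ℝ)).smulRight
        (EuclideanSpace.proj i : E d →L[ℝ] ℝ)) x := by
    refine HasFDerivAt.fun_sum fun i _ => ?_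
    have h1 : HasDerivAt (deriv v) (deriv (deriv v) (x i)) (x i) :=
      (hv'.differentiable (by norm_num) _).hasDerivAt
    have h2 := h1.fun_neg.comp_hasFDerivAt (f := fun y : E d => y i) x
      (EuclideanSpace.proj i : E d →L[ℝ] ℝ).hasFDerivAt
    exact h2.smul_const (EuclideanSpace.proj i : E d →L[ℝ] ℝ)
  rw [show fderiv ℝ (logDensity v d) = _ from funext fun x => (hasFDerivAt_logDensity hv x).fderiv,
    h.fderiv]
  simp

/-! ### Geometry of the coordinate half-space. -/

variable {N : ℕ} {t : ℝ}

/-- The defining function `x_(N+1) - t` of the coordinate half-space. -/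
def heightFunction (N : ℕ) (t : ℝ) (x : E (N + 1)) : ℝ := x (Fin.last N) - t

/-- The last vector of the standard basis. -/
noncomputable def lastVector (N : ℕ) : E (N + 1) := EuclideanSpace.single (Fin.last N) 1

theorem norm_lastVector : ‖lastVector N‖ = 1 := by simp [lastVector]

theorem inner_gradient {d : ℕ} (f : E d → ℝ) (x y : E d) :
    inner ℝ (gradient f x) y = fderiv ℝ f x y := by
  simp [gradient]

theorem gradient_apply {d : ℕ} (f : E d → ℝ) (x : E d) (i : Fin d) :
    gradient f x i = fderiv ℝ f x (EuclideanSpace.single i 1) := by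
  rw [← inner_gradient, EuclideanSpace.inner_single_right]
  simp

theorem hasFDerivAt_heightFunction (x : E (N + 1)) :
    HasFDerivAt (heightFunction N t) (EuclideanSpace.proj (Fin.last N) : E (N + 1) →L[ℝ] ℝ) x :=
  (EuclideanSpace.proj (Fin.last N) : E (N + 1) →L[ℝ] ℝ).hasFDerivAt.sub_const t

theorem gradient_heightFunction (x : E (N + 1)) :
    gradient (heightFunction N t) x = lastVector N := by
  ext i
  rw [gradient_apply, (hasFDerivAt_heightFunction x).fderiv]
  simp [lastVector, eq_comm]

theorem unitNormal_heightFunction : unitNormal (heightFunction N t) = fun _ => lastVector N := by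
  ext1 x
  simp [unitNormal, gradient_heightFunction, norm_lastVector]

theorem shapeOperator_heightFunction (x : E (N + 1)) :
    shapeOperator (heightFunction N t) x = 0 := by
  simp [shapeOperator, unitNormal_heightFunction]

theorem norm_sq_tangentialGradient (u : E (N + 1) → ℝ) (x : E (N + 1)) :
    ‖tangentialGradient (heightFunction N t) u x‖ ^ 2 =
      ∑ i : Fin N, fderiv ℝ u x (EuclideanSpace.single i.castSucc 1) ^ 2 := by
  have h : tangentialGradient (heightFunction N t) u x =
      gradient u x - gradient u x (Fin.last N) • lastVector N := by
    simp only [tangentialGradient, tangentProj, unitNormal_heightFunction]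
    rw [Submodule.starProjection_orthogonal', sub_apply,
      Submodule.starProjection_unit_singleton ℝ norm_lastVector]
    simp [lastVector, gradient_apply]
  rw [h, EuclideanSpace.norm_sq_eq, Fin.sum_univ_castSucc]
  simp [lastVector, gradient_apply, (Fin.castSucc_lt_last _).ne]

theorem isOpenMap_last : IsOpenMap fun x : E (N + 1) => x (Fin.last N) :=
  (EuclideanSpace.proj (Fin.last N) : E (N + 1) →L[ℝ] ℝ).isOpenMap fun a =>
    ⟨EuclideanSpace.single (Fin.last N) a, by simp⟩

theorem frontier_coordHalfSpace :
    frontier (coordHalfSpace N t) = {x | x (Fin.last N) = t} := by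
  have := isOpenMap_last.preimage_frontier_eq_frontier_preimage
    (by fun_prop : Continuous fun x : E (N + 1) => x (Fin.last N)) (Set.Iic t)
  rw [frontier_Iic] at this
  exact this.symm

theorem interior_coordHalfSpace :
    interior (coordHalfSpace N t) = {x | x (Fin.last N) < t} := by
  have := isOpenMap_last.preimage_interior_eq_interior_preimage
    (by fun_prop : Continuous fun x : E (N + 1) => x (Fin.last N)) (Set.Iic t)
  rw [interior_Iic] at this
  exact this.symm

theorem isDefiningFunction_heightFunction :
    IsDefiningFunction (heightFunction N t) (coordHalfSpace N t) where
  contDiff := by unfold heightFunction; fun_prop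
  interior_eq := by simp [interior_coordHalfSpace, heightFunction, sub_neg]
  frontier_eq := by simp [frontier_coordHalfSpace, heightFunction, sub_eq_zero]
  gradient_ne_zero x _ := by
    rw [gradient_heightFunction, ← norm_ne_zero_iff, norm_lastVector]
    exact one_ne_zero

/-- The parametrization of the hyperplane `{x_(N+1) = t}` by the first `N` coordinates. -/
def hyperplanePoint (t : ℝ) (y : Fin N → ℝ) : E (N + 1) := WithLp.toLp 2 (Fin.snoc y t)

@[simp]
theorem hyperplanePoint_last (y : Fin N → ℝ) : hyperplanePoint t y (Fin.last N) = t := by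
  simp [hyperplanePoint]

@[simp]
theorem hyperplanePoint_castSucc (y : Fin N → ℝ) (i : Fin N) :
    hyperplanePoint t y i.castSucc = y i := by
  simp [hyperplanePoint]

theorem range_hyperplanePoint :
    Set.range (hyperplanePoint t : (Fin N → ℝ) → E (N + 1)) = {x | x (Fin.last N) = t} := by
  ext x
  constructor
  · rintro ⟨y, rfl⟩; simp
  · intro hx
    refine ⟨fun i => x i.castSucc, ?_⟩
    ext i
    refine Fin.lastCases ?_ (fun j => ?_) i
    · simpa using hx.symm
    · simp

/-- The domain is `E N` because the sup norm of `Fin N → ℝ` would in general break the isometry, by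
which the area element is carried to Lebesgue measure. -/
theorem isometry_hyperplanePoint :
    Isometry fun y : E N => hyperplanePoint t y.ofLp := by
  refine Isometry.of_dist_eq fun y z => ?_
  rw [EuclideanSpace.dist_eq, EuclideanSpace.dist_eq, Fin.sum_univ_castSucc]
  simp

/-- Integration over the boundary of the half-space is integration over `ℝ^N`. -/
theorem boundaryIntegral_coordHalfSpace (g : E (N + 1) → ℝ) :
    boundaryIntegral (coordHalfSpace N t) g = ∫ y : Fin N → ℝ, g (hyperplanePoint t y) := by
  have hiso := isometry_hyperplanePoint (N := N) (t := t)
  have hrange : Set.range (fun y : E N => hyperplanePoint t y.ofLp) =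
      {x | x (Fin.last N) = t} := by
    rw [← range_hyperplanePoint]
    exact (WithLp.ofLp_surjective 2).range_comp (hyperplanePoint t)
  rw [boundaryIntegral, frontier_coordHalfSpace, ← hrange, ← hiso.map_euclideanHausdorffMeasure,
    hiso.isClosedEmbedding.measurableEmbedding.integral_map,
    EuclideanSpace.euclideanHausdorffMeasure_eq_volume,
    ← (PiLp.volume_preserving_toLp (Fin N)).integral_comp
      (MeasurableEquiv.toLp 2 (Fin N → ℝ)).measurableEmbedding]

/-- The linear part of `hyperplanePoint`. -/
noncomputable def hyperplaneDirection (N : ℕ) : (Fin N → ℝ) →L[ℝ] E (N + 1) :=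
  ∑ i, (ContinuousLinearMap.proj i : (Fin N → ℝ) →L[ℝ] ℝ).smulRight
    (EuclideanSpace.single i.castSucc (1 : ℝ))

theorem hyperplanePoint_eq (y : Fin N → ℝ) :
    hyperplanePoint t y = hyperplaneDirection N y + t • lastVector N := by
  ext i
  refine Fin.lastCases ?_ (fun j => ?_) i
  · simp [hyperplaneDirection, lastVector]
  · simp [hyperplaneDirection, lastVector, Pi.single_apply]

theorem hyperplaneDirection_single (i : Fin N) :
    hyperplaneDirection N (Pi.single i 1) = EuclideanSpace.single i.castSucc 1 := by
  simp [hyperplaneDirection, Pi.single_apply]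

theorem hasFDerivAt_hyperplanePoint (y : Fin N → ℝ) :
    HasFDerivAt (hyperplanePoint t) (hyperplaneDirection N) y := by
  rw [show hyperplanePoint t = fun y => hyperplaneDirection N y + t • lastVector N from
    funext hyperplanePoint_eq]
  exact (hyperplaneDirection N).hasFDerivAt.add_const _

theorem contDiff_hyperplanePoint {n : WithTop ℕ∞} :
    ContDiff ℝ n (hyperplanePoint t : (Fin N → ℝ) → E (N + 1)) := by
  rw [show hyperplanePoint t = fun y => hyperplaneDirection N y + t • lastVector N from
    funext hyperplanePoint_eq]
  exact (hyperplaneDirection N).contDiff.add contDiff_const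

theorem hasCompactSupport_comp_hyperplanePoint {u : E (N + 1) → ℝ} (hu : HasCompactSupport u) :
    HasCompactSupport (u ∘ hyperplanePoint t) :=
  HasCompactSupport.intro
    (hu.isCompact.image (by fun_prop : Continuous fun (x : E (N + 1)) (i : Fin N) => x i.castSucc))
    fun y hy => image_eq_zero_of_notMem_tsupport (f := u) fun h =>
      hy ⟨hyperplanePoint t y, h, by ext i; simp⟩

theorem exp_logDensity_hyperplanePoint (v : ℝ → ℝ) (y : Fin N → ℝ) :
    Real.exp (logDensity v (N + 1) (hyperplanePoint t y)) =
      Real.exp (∑ i, -v (y i)) * Real.exp (-v t) := by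
  simp [logDensity, Fin.sum_univ_castSucc, Real.exp_add, mul_comm]

/-! ### Stability from the Poincaré inequality. -/

theorem isStable_coordHalfSpace {v : ℝ → ℝ} (hv : ContDiff ℝ 2 v) {μ : Measure ℝ}
    [IsProbabilityMeasure μ]
    (hμ : μ = volume.withDensity fun x => ENNReal.ofReal (Real.exp (-v x)))
    (ht : PoincareOnLine μ (deriv (deriv v) t)) :
    IsStable (productMeasure μ (N + 1)) (coordHalfSpace N t) := by
  refine ⟨logDensity v (N + 1), heightFunction N t, hasLogDensity_productMeasure hv hμ _,
    isDefiningFunction_heightFunction, ⟨deriv v t, fun x hx => ?_⟩, fun u hu hs hmean => ?_⟩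
  · rw [frontier_coordHalfSpace, Set.mem_ofPred_eq] at hx
    rw [genMeanCurv, sumCurv, shapeOperator_heightFunction, inner_gradient,
      (hasFDerivAt_logDensity hv x).fderiv, unitNormal_heightFunction]
    simp [lastVector, hx]
  · have cv := hv.continuous
    have hu1 : ContDiff ℝ 1 u := hu.of_le (by simp)
    have hI : ∀ g : (Fin N → ℝ) → ℝ, ∫ y, g y ∂(Measure.pi fun _ => μ) =
        ∫ y, g y * Real.exp (∑ i, -v (y i)) := fun g => by
      rw [pi_eq_withDensity cv hμ, integral_expDensity (by fun_prop)]
    have hp := poincare_pi ht N (u ∘ hyperplanePoint t) (hu1.comp contDiff_hyperplanePoint)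
      (hasCompactSupport_comp_hyperplanePoint hs)
    have hd : ∀ (y : Fin N → ℝ) (i : Fin N), fderiv ℝ (u ∘ hyperplanePoint t) y (Pi.single i 1) =
        fderiv ℝ u (hyperplanePoint t y) (EuclideanSpace.single i.castSucc 1) := fun y i => by
      rw [((hu1.differentiable one_ne_zero _).hasFDerivAt.comp y
        (hasFDerivAt_hyperplanePoint y)).fderiv, ContinuousLinearMap.comp_apply,
        hyperplaneDirection_single]
    -- On the hyperplane the density is that of `μ^N` times the constant `e^{-v(t)}`, so the
    -- weighted mean condition says that the restriction of `u` has mean zero for `μ^N`.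
    have h0 : ∫ y, (u ∘ hyperplanePoint t) y ∂(Measure.pi fun _ => μ) = 0 := by
      rw [boundaryIntegral_coordHalfSpace] at hmean
      simp only [exp_logDensity_hyperplanePoint, ← mul_assoc] at hmean
      rw [integral_mul_const, mul_eq_zero, or_iff_left (Real.exp_pos _).ne'] at hmean
      rw [hI]
      exact hmean
    rw [h0] at hp
    simp only [hI, hd, Function.comp_apply] at hp
    have hsq : sumSqCurv (heightFunction N t) = fun _ => 0 := by
      ext x; simp [sumSqCurv, shapeOperator_heightFunction]
    have hhess : ∀ y : Fin N → ℝ, fderiv ℝ (fderiv ℝ (logDensity v (N + 1))) (hyperplanePoint t y)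
        (lastVector N) (lastVector N) = -deriv (deriv v) t := fun y => by
      rw [fderiv_fderiv_logDensity hv, Fin.sum_univ_castSucc]
      simp [lastVector]
    have e : indexForm (logDensity v (N + 1)) (heightFunction N t) (coordHalfSpace N t) u =
        Real.exp (-v t) *
        (∫ y : Fin N → ℝ, (∑ i : Fin N, fderiv ℝ u (hyperplanePoint t y)
          (EuclideanSpace.single i.castSucc 1) ^ 2) * Real.exp (∑ i, -v (y i))) +
        (-(Real.exp (-v t) * deriv (deriv v) t)) *
          ∫ y : Fin N → ℝ, u (hyperplanePoint t y) ^ 2 * Real.exp (∑ i, -v (y i)) := by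
      rw [indexForm, boundaryIntegral_coordHalfSpace, boundaryIntegral_coordHalfSpace,
        ← integral_const_mul, ← integral_const_mul]
      simp only [hsq, unitNormal_heightFunction, norm_sq_tangentialGradient, hhess,
        exp_logDensity_hyperplanePoint]
      congr 1 <;> (congr 1; ext y; ring)
    rw [e]
    have := mul_le_mul_of_nonneg_left hp (Real.exp_pos (-v t)).le
    linarith

end HalfSpaceStability

theorem proposition3p5 (N : ℕ) (v : ℝ → ℝ) (hv : ContDiff ℝ 2 v)
    (μ : MeasureTheory.Measure ℝ) [MeasureTheory.IsProbabilityMeasure μ]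
    (hμ : μ = MeasureTheory.volume.withDensity fun x => ENNReal.ofReal (Real.exp (-v x))) :
    ∃ t : ℝ, HalfSpaceStability.IsStable (HalfSpaceStability.productMeasure μ (N + 1))
      (HalfSpaceStability.coordHalfSpace N t) := by
  obtain ⟨t, ht⟩ := HalfSpaceStability.exists_poincareOnLine hv hμ
  exact ⟨t, HalfSpaceStability.isStable_coordHalfSpace hv hμ ht⟩
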